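/- There is an absolute constant $K$ such that the following holds. Let $\alpha > 0$ be a constant. Then there are constants $\kappa, c > 0$ (depending only on $\alpha$) such that for every integer $n_0$ there is an integer $n \ge n_0$ with the following property. Let $n^{-1/2+\alpha} \le \epsilon < 1$, let $s \le \kappa\, n^{1+\alpha}$ be a non-negative integer (for instance $s = s(n)$ with $s(n) = o(n^{1+\alpha})$, once $n_0$ is large enough), and let $\rho$ be a real number. Suppose that there is a randomized one-pass streaming algorithm with at most $s$ bits of memory which, on every unweighted $n$-vertex hypergraph $G=(V,E)$ with at most $n^K$ edges, whose edges $e_0, e_1, \dots, e_{m-1}$ are presented one by one, outputs a set of identifiers of edges forming an edge $(1-\epsilon)$-cover $F$ of $G$ with $\mathbb{E}\,|F| \le \rho\cdot|\mathrm{OPT}|$. Then $$\rho \;\ge\; c\cdot \frac{\log\log n}{\log n}\cdot\frac{1}{\epsilon}.$$ Here the edges of a hypergraph form a multiset of non-empty subsets of $V$, and every vertex lies in at least one edge; the identifier of an edge is its arrival time; $F \subseteq E$ is an edge $\delta$-cover if at least $\delta n$ vertices lie in some edge of $F$; $\mathrm{OPT}$ is an edge $1$-cover of $G$ of minimum cardinality;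 the memory bound applies to the memory image kept between the arrivals of two consecutive edges, and the random coins are not counted in it. -/

import Mathlib

open MeasureTheory

universe u

namespace EdgeCover

/-- An unweighted hypergraph on the `n` vertices `Fin n` with a multiset of `m` edges, listed in
their order of arrival. The identifier of an edge is its arrival time `t : Fin m`. Edges are
non-empty and there are no isolated vertices. -/
structure StreamHypergraph (n m : ℕ) where
  edge : Fin m → Finset (Fin n)
  edge_nonempty : ∀ t, (edge t).Nonempty
  no_isolated : ∀ v, ∃ t, v ∈ edge t

namespace StreamHypergraph

variable {n m : ℕ}

/-- `V(F)`: the vertices incident to the edges whose identifiers are in `F`. -/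
def coveredBy (G : StreamHypergraph n m) (F : Finset (Fin m)) : Finset (Fin n) :=
  F.biUnion G.edge

/-- `F` is an edge `δ`-cover of `G`: it covers at least `δ n` vertices. -/
def IsCover (G : StreamHypergraph n m) (δ : ℝ) (F : Finset (Fin m)) : Prop :=
  δ * (n : ℝ) ≤ ((G.coveredBy F).card : ℝ)

/-- The cardinality of an optimal edge `1`-cover of `G` (one exists, since no vertex is
isolated). -/
noncomputable def optCard (G : StreamHypergraph n m) : ℕ :=
  sInf {k : ℕ | ∃ F : Finset (Fin m), G.IsCover 1 F ∧ F.card = k}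

end StreamHypergraph

/-- A deterministic one-pass streaming algorithm with `s` bits of memory for `n`-vertex
hypergraphs. When the edge with identifier `t` arrives, the new memory image is a function of `t`,
of the vertex set of the edge, and of the old memory image. At the end of a stream of `m` edges
the algorithm outputs a set of identifiers, as a function of `m` and of the memory image.
No restriction is put on the way these functions are computed. -/
structure StreamAlg (n s : ℕ) where
  init : Fin s → Bool
  update : ℕ → Finset (Fin n) → (Fin s → Bool) → (Fin s → Bool)
  output : (m : ℕ) → (Fin s → Bool) → Finset (Fin m)

/-- The output of the algorithm on the stream `edge 0, edge 1, …, edge (m - 1)`. -/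
def StreamAlg.run {n s m : ℕ} (A : StreamAlg n s) (edge : Fin m → Finset (Fin n)) :
    Finset (Fin m) :=
  A.output m (Fin.foldl m (fun mem t => A.update t (edge t) mem) A.init)

/-- A randomized one-pass streaming algorithm with `s` bits of memory: its coin tosses
`ω : Ω` (which are not charged to the memory) select a deterministic one, and on every stream the
output is a random variable. -/
structure RandStreamAlg (n s : ℕ) where
  Ω : Type u
  [measurableSpace : MeasurableSpace Ω]
  P : Measure Ω
  [isProbabilityMeasure : IsProbabilityMeasure P]
  alg : Ω → StreamAlg n s
  measurableSet_run : ∀ (m : ℕ) (edge : Fin m → Finset (Fin n)) (F : Finset (Fin m)),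
    MeasurableSet {ω | (alg ω).run edge = F}

attribute [instance] RandStreamAlg.measurableSpace RandStreamAlg.isProbabilityMeasure

/-- `A`, whose memory has `s` bits, is an uncertified `(n, s, ε, ρ)`-algorithm for the hypergraphs
with at most `M` edges: on each of them it outputs the identifiers of an edge `(1 - ε)`-cover
whose expected cardinality is at most `ρ · |OPT|`. -/
def RandStreamAlg.IsUncertified {n s : ℕ} (A : RandStreamAlg.{u} n s) (M : ℕ) (ε ρ : ℝ) : Prop :=
  ∀ (m : ℕ), m ≤ M → ∀ G : StreamHypergraph n m,
    (∀ᵐ ω ∂A.P, G.IsCover (1 - ε) ((A.alg ω).run G.edge)) ∧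
    ∫ ω, (((A.alg ω).run G.edge).card : ℝ) ∂A.P ≤ ρ * (G.optCard : ℝ)

end EdgeCover

/-!
Draw independent random functions `f 0, …, f (m - 1) : X → Y` and a random index `i`, place the grid
`X × Y` in the vertex set, and stream the graphs of the `f j`, followed by the complement of the
graph of `f i`. Edge `i` and the last edge cover everything, so `OPT ≤ 2`.

A deterministic algorithm that keeps far fewer than `m` bits has forgotten most of the indices by
the time `i` is revealed: the index of edge `i` has to be guessed from `f i` and the memory image,
and a union bound over the memory images shows that an output of at most `R` edges contains edge `i`
with probability at most `1 / 4`. An output without edge `i` has to cover the graph of `f i` by the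
other graphs, which typically meet it in fewer than `t` vertices each, `t` being of the order of
`ε² n` when `X` has about `4 ε n` elements and `Y` about `1 / (4 ε)`. Up to the `ε n` vertices that
may be left out this takes more than `R` edges, where `R` is of the order of `1 / ε`. By Yao's
principle some fixed `f` and `i` are as bad for the randomized algorithm.
-/

namespace EdgeCover

open Finset
open scoped BigOperators

section FiniteAverages

theorem expect_pi_prod {ι K : Type*} [Fintype ι] [DecidableEq ι] {G : ι → Type*}
    [∀ i, Fintype (G i)] [Semifield K] [CharZero K] (F : ∀ i, G i → K) :
    𝔼 f : ∀ i, G i, ∏ i, F i (f i) = ∏ i, 𝔼 g, F i g := by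
  simp only [Fintype.expect_eq_sum_div_card, prod_div_distrib, Fintype.prod_sum,
    Fintype.card_pi, Nat.cast_prod]

variable {ι G X : Type*} [Fintype ι] [Fintype G] [Fintype X]

theorem expect_two_pow_card_le_exp [DecidableEq ι] [DecidableEq G] [Nonempty G]
    (P : ι → Finset G) :
    𝔼 f : ι → G, (2 : ℝ) ^ #{i | f i ∈ P i} ≤
      Real.exp (∑ i, (#(P i) : ℝ) / Fintype.card G) := by
  have two_pow_eq_prod (f : ι → G) :
      (2 : ℝ) ^ #{i | f i ∈ P i} = ∏ i, (1 + if f i ∈ P i then 1 else 0) := by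
    simp only [← prod_const, prod_filter]
    exact prod_congr rfl fun i _ => by split_ifs <;> norm_num
  have expect_factor (i : ι) :
      𝔼 g : G, (1 + if g ∈ P i then (1 : ℝ) else 0) = 1 + #(P i) / Fintype.card G := by
    simp [expect_add_distrib, Fintype.expect_eq_sum_div_card]
  simp only [two_pow_eq_prod]
  rw [expect_pi_prod (fun i g => 1 + if g ∈ P i then (1 : ℝ) else 0), Real.exp_sum]
  refine prod_le_prod (fun i _ => ?_) (fun i _ => ?_) <;> rw [expect_factor]
  · positivity
  · linarith [Real.add_one_le_exp ((#(P i) : ℝ) / Fintype.card G)]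

theorem expect_indicator_le_expect_two_pow_div (Y : X → ℕ) (t : ℕ) :
    𝔼 x, (if t ≤ Y x then (1 : ℝ) else 0) ≤ (𝔼 x, (2 : ℝ) ^ Y x) / 2 ^ t := by
  rw [expect_div]
  refine expect_le_expect fun x _ => ?_
  split_ifs with h
  · rw [one_le_div₀ (by positivity)]
    exact pow_le_pow_right₀ one_le_two h
  · positivity

theorem expect_le_log_expect_exp [Nonempty X] (Z : X → ℝ) :
    𝔼 x, Z x ≤ Real.log (𝔼 x, Real.exp (Z x)) := by
  set c := Real.log (𝔼 x, Real.exp (Z x))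
  have exp_c : Real.exp c = 𝔼 x, Real.exp (Z x) :=
    Real.exp_log (expect_pos (fun x _ => Real.exp_pos (Z x)) univ_nonempty)
  have expect_exp_sub : 𝔼 x, Real.exp (Z x - c) = 1 := by
    simp only [Real.exp_sub, ← expect_div, exp_c]
    exact div_self (exp_c ▸ (Real.exp_pos c).ne')
  have h : 𝔼 x, (Z x - c + 1) ≤ 𝔼 x, Real.exp (Z x - c) :=
    expect_le_expect fun x _ => Real.add_one_le_exp _
  rw [expect_exp_sub, expect_add_distrib, expect_sub_distrib, Fintype.expect_const,
    Fintype.expect_const] at h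
  linarith

-- Condition on all coordinates of `f` but `j`.
theorem expect_apply_apply_le [DecidableEq ι] [Nonempty G] {i j : ι} (hij : i ≠ j)
    {F : G → G → ℝ} {c : ℝ} (hF : ∀ g, 𝔼 h, F g h ≤ c) :
    𝔼 f : ι → G, F (f i) (f j) ≤ c := by
  rw [Fintype.expect_equiv (Equiv.funSplitAt j G) (fun f => F (f i) (f j))
      (fun p => F (p.2 ⟨i, hij⟩) p.1) (fun f => rfl),
    ← univ_product_univ, expect_product, expect_comm]
  exact expect_le univ_nonempty fun p _ => hF (p ⟨i, hij⟩)

theorem exists_le_integral_of_ae_le_expect [Nonempty X] {Ω : Type*} [MeasurableSpace Ω]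
    {P : Measure Ω} [IsProbabilityMeasure P] {Z : X → Ω → ℝ} (hZ : ∀ x, Integrable (Z x) P)
    {c : ℝ} (hc : ∀ᵐ ω ∂P, c ≤ 𝔼 x, Z x ω) :
    ∃ x, c ≤ ∫ ω, Z x ω ∂P := by
  have le_expect_integral : c ≤ 𝔼 x, ∫ ω, Z x ω ∂P := by
    simp only [Fintype.expect_eq_sum_div_card] at hc ⊢
    rw [← integral_finsetSum _ fun x _ => hZ x, ← integral_div]
    calc c = ∫ _, c ∂P := by simp
      _ ≤ _ := integral_mono_ae (integrable_const c)
        ((integrable_finsetSum _ fun x _ => hZ x).div_const _) hc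
  simpa using exists_le_of_le_expect univ_nonempty le_expect_integral

end FiniteAverages

section Guessing

variable {ι G Mem : Type*} [Fintype ι] [DecidableEq ι] [Fintype G] [Nonempty G] [Fintype Mem]

theorem expect_two_pow_card_guess_le {S : G → Finset ι} {R : ℝ} (hS : ∀ g, (#(S g) : ℝ) ≤ R) :
    𝔼 f : ι → G, (2 : ℝ) ^ #{i | i ∈ S (f i)} ≤ Real.exp R := by
  classical
  have h := expect_two_pow_card_le_exp fun i : ι => ({g | i ∈ S g} : Finset G)
  simp only [mem_filter, mem_univ, true_and] at h
  refine h.trans (Real.exp_le_exp.mpr ?_)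
  have double_count : ∑ i, (#{g | i ∈ S g} : ℝ) = ∑ g, (#(S g) : ℝ) := by
    have := sum_card_bipartiteAbove_eq_sum_card_bipartiteBelow
      (s := (univ : Finset ι)) (t := (univ : Finset G)) (fun i g => i ∈ S g)
    simp only [bipartiteAbove, bipartiteBelow, filter_univ_mem] at this
    exact_mod_cast this
  rw [← sum_div, double_count, ← Fintype.expect_eq_sum_div_card]
  exact expect_le univ_nonempty fun g _ => hS g

-- For a fixed memory image the guesses `i ∈ S mem (f i)` are independent over `i`; a union bound
-- over the memory images costs a factor `card Mem` in the exponential moment.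
theorem expect_card_guess_mul_log_two_le (M : (ι → G) → Mem) {S : Mem → G → Finset ι} {R : ℝ}
    (hS : ∀ mem g, (#(S mem g) : ℝ) ≤ R) :
    (𝔼 f : ι → G, (#{i | i ∈ S (M f) (f i)} : ℝ)) * Real.log 2 ≤
      Real.log (Fintype.card Mem) + R := by
  have : Nonempty Mem := (inferInstance : Nonempty (ι → G)).map M
  have exp_moment : 𝔼 f : ι → G, (2 : ℝ) ^ #{i | i ∈ S (M f) (f i)} ≤
      Fintype.card Mem * Real.exp R := by
    calc 𝔼 f : ι → G, (2 : ℝ) ^ #{i | i ∈ S (M f) (f i)}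
        ≤ 𝔼 f : ι → G, ∑ mem, (2 : ℝ) ^ #{i | i ∈ S mem (f i)} :=
          expect_le_expect fun f _ => single_le_sum
            (f := fun mem => (2 : ℝ) ^ #{i | i ∈ S mem (f i)})
            (fun _ _ => by positivity) (mem_univ (M f))
      _ = ∑ mem, 𝔼 f : ι → G, (2 : ℝ) ^ #{i | i ∈ S mem (f i)} := expect_sum_comm _ _ _
      _ ≤ ∑ _mem : Mem, Real.exp R := sum_le_sum fun mem _ => expect_two_pow_card_guess_le (hS mem)
      _ = Fintype.card Mem * Real.exp R := by simp
  have exp_moment_pos : 0 < 𝔼 f : ι → G, (2 : ℝ) ^ #{i | i ∈ S (M f) (f i)} :=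
    expect_pos (fun _ _ => by positivity) univ_nonempty
  calc (𝔼 f : ι → G, (#{i | i ∈ S (M f) (f i)} : ℝ)) * Real.log 2
      = 𝔼 f : ι → G, (#{i | i ∈ S (M f) (f i)} : ℝ) * Real.log 2 := expect_mul _ _ _
    _ ≤ Real.log (𝔼 f : ι → G, (2 : ℝ) ^ #{i | i ∈ S (M f) (f i)}) := by
        refine (expect_le_log_expect_exp _).trans_eq ?_
        simp only [Real.exp_nat_mul, Real.exp_log two_pos]
    _ ≤ Real.log (Fintype.card Mem * Real.exp R) := Real.log_le_log exp_moment_pos exp_moment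
    _ = Real.log (Fintype.card Mem) + R := by
        rw [Real.log_mul (by simp) (Real.exp_ne_zero R), Real.log_exp]

end Guessing

section Agreement

variable {ι X Y : Type*} [Fintype ι] [DecidableEq ι] [Fintype X] [DecidableEq X] [Fintype Y]
  [DecidableEq Y] [Nonempty Y]

theorem expect_agree_le (h : X → Y) (t : ℕ) :
    𝔼 g : X → Y, (if t ≤ #{x | g x = h x} then (1 : ℝ) else 0) ≤
      Real.exp (Fintype.card X / Fintype.card Y) / 2 ^ t := by
  refine (expect_indicator_le_expect_two_pow_div _ t).trans ?_
  gcongr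
  simpa [div_eq_mul_inv] using expect_two_pow_card_le_exp fun x => ({h x} : Finset Y)

theorem expect_exists_agree_le (i : ι) (t : ℕ)
    [DecidablePred fun f : ι → X → Y => ∃ j ≠ i, t ≤ #{x | f j x = f i x}] :
    𝔼 f : ι → X → Y, (if ∃ j ≠ i, t ≤ #{x | f j x = f i x} then (1 : ℝ) else 0) ≤
      Fintype.card ι * (Real.exp (Fintype.card X / Fintype.card Y) / 2 ^ t) := by
  set δ := Real.exp (Fintype.card X / Fintype.card Y) / 2 ^ t
  have pairwise (j : ι) :
      𝔼 f : ι → X → Y, (if j ≠ i ∧ t ≤ #{x | f j x = f i x} then (1 : ℝ) else 0) ≤ δ := by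
    by_cases hj : j = i
    · simp only [hj, ne_eq, not_true_eq_false, false_and, if_false, expect_const_zero]
      positivity
    · simp only [ne_eq, hj, not_false_eq_true, true_and]
      exact expect_apply_apply_le (Ne.symm hj) (expect_agree_le · t)
  calc _ ≤ 𝔼 f : ι → X → Y, ∑ j,
          (if j ≠ i ∧ t ≤ #{x | f j x = f i x} then (1 : ℝ) else 0) := by
        refine expect_le_expect fun f _ => ?_
        split_ifs with h
        · obtain ⟨j, hj⟩ := h
          refine le_trans ?_ (single_le_sum (fun k _ => ?_) (mem_univ j))
          · rw [if_pos hj]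
          · split_ifs <;> norm_num
        · exact sum_nonneg fun k _ => by split_ifs <;> norm_num
    _ = ∑ j, 𝔼 f : ι → X → Y,
          (if j ≠ i ∧ t ≤ #{x | f j x = f i x} then (1 : ℝ) else 0) := expect_sum_comm _ _ _
    _ ≤ ∑ _j : ι, δ := sum_le_sum fun j _ => pairwise j
    _ = Fintype.card ι * δ := by simp

end Agreement

namespace StreamHypergraph

variable {n m : ℕ} {G : StreamHypergraph n m} {F : Finset (Fin m)}

theorem optCard_le_card (hF : G.IsCover 1 F) : G.optCard ≤ #F :=
  Nat.sInf_le ⟨F, hF, rfl⟩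

theorem isCover_one_of_coveredBy_eq_univ (hF : G.coveredBy F = univ) : G.IsCover 1 F := by
  simp [IsCover, hF]

theorem IsCover.card_sub_le_card_mul {ε : ℝ} (hF : G.IsCover (1 - ε) F) {W : Finset (Fin n)}
    {t : ℕ} (ht : ∀ k ∈ F, #(W ∩ G.edge k) ≤ t) :
    (#W : ℝ) - ε * n ≤ #F * t := by
  have covered : #(W ∩ G.coveredBy F) ≤ #F * t := by
    rw [coveredBy, inter_biUnion]
    exact card_biUnion_le_card_mul _ _ _ ht
  have split : #W ≤ #(W ∩ G.coveredBy F) + #(G.coveredBy F)ᶜ := by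
    rw [← card_inter_add_card_sdiff W (G.coveredBy F)]
    gcongr
    exact fun v hv => mem_compl.mpr (mem_sdiff.mp hv).2
  have uncovered : (#(G.coveredBy F)ᶜ : ℝ) = n - #(G.coveredBy F) := by
    rw [card_compl, Nat.cast_sub (card_le_univ _), Fintype.card_fin]
  have covers : (1 - ε) * n ≤ #(G.coveredBy F) := hF
  have covered' : (#(W ∩ G.coveredBy F) : ℝ) ≤ #F * t := mod_cast covered
  have split' : (#W : ℝ) ≤ #(W ∩ G.coveredBy F) + #(G.coveredBy F)ᶜ := mod_cast split
  linarith

theorem IsCover.nonempty {δ : ℝ} (hF : G.IsCover δ F) (hδ : 0 < δ) (hn : 0 < n) :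
    F.Nonempty := by
  rw [nonempty_iff_ne_empty]
  rintro rfl
  have : 0 < δ * n := by positivity
  simp only [IsCover, coveredBy, biUnion_empty, card_empty, Nat.cast_zero] at hF
  linarith

end StreamHypergraph

section HardHypergraph

variable {X Y V : Type*} [Fintype X]

/-- The graph of `g : X → Y`, as a set of vertices of the grid `X × Y` placed in the vertex set
`V` by `φ`. -/
def graphEdge (φ : X × Y ↪ V) (g : X → Y) : Finset V :=
  univ.map ⟨fun x => φ (x, g x), fun x y h => by simpa using congrArg Prod.fst (φ.injective h)⟩

theorem mem_graphEdge {φ : X × Y ↪ V} {g : X → Y} {v : V} :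
    v ∈ graphEdge φ g ↔ ∃ x, φ (x, g x) = v := by
  rw [graphEdge, mem_map]
  exact ⟨fun ⟨x, _, hx⟩ => ⟨x, hx⟩, fun ⟨x, hx⟩ => ⟨x, mem_univ x, hx⟩⟩

theorem apply_mem_graphEdge {φ : X × Y ↪ V} {g : X → Y} {x : X} {y : Y} :
    φ (x, y) ∈ graphEdge φ g ↔ g x = y := by
  simp [mem_graphEdge]

theorem card_graphEdge (φ : X × Y ↪ V) (g : X → Y) : #(graphEdge φ g) = Fintype.card X := by
  simp [graphEdge]

theorem card_graphEdge_inter_le [DecidableEq Y] [DecidableEq V] (φ : X × Y ↪ V) (g h : X → Y) :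
    #(graphEdge φ g ∩ graphEdge φ h) ≤ #{x | h x = g x} := by
  refine (card_le_card fun v hv => ?_).trans
    (card_image_le (f := fun x => φ (x, g x)))
  obtain ⟨hvg, hvh⟩ := mem_inter.mp hv
  obtain ⟨x, rfl⟩ := mem_graphEdge.mp hvg
  exact mem_image_of_mem _ (mem_filter.mpr ⟨mem_univ x, apply_mem_graphEdge.mp hvh⟩)

variable {n m : ℕ} (φ : X × Y ↪ Fin n)

/-- The hard stream: the graphs of `f 0, f 1, …`, closed by the complement of the graph of `f i`.
Every small cover has to use the edge `i`, but `i` is only revealed by the last edge. -/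
def hardStream (f : Fin m → X → Y) (i : Fin m) : Fin (m + 1) → Finset (Fin n) :=
  Fin.snoc (α := fun _ => Finset (Fin n)) (fun j => graphEdge φ (f j)) (graphEdge φ (f i))ᶜ

@[simp]
theorem hardStream_castSucc (f : Fin m → X → Y) (i j : Fin m) :
    hardStream φ f i j.castSucc = graphEdge φ (f j) := by
  simp [hardStream]

@[simp]
theorem hardStream_last (f : Fin m → X → Y) (i : Fin m) :
    hardStream φ f i (Fin.last m) = (graphEdge φ (f i))ᶜ := by
  simp [hardStream]

variable [Nonempty X] [Nontrivial Y]

theorem hardStream_nonempty (f : Fin m → X → Y) (i : Fin m) (t : Fin (m + 1)) :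
    (hardStream φ f i t).Nonempty := by
  induction t using Fin.lastCases with
  | last =>
    obtain ⟨x⟩ := ‹Nonempty X›
    obtain ⟨y, hy⟩ := exists_ne (f i x)
    exact ⟨φ (x, y), by simpa [apply_mem_graphEdge] using hy.symm⟩
  | cast j =>
    rw [hardStream_castSucc, ← card_pos, card_graphEdge]
    exact Fintype.card_pos

/-- The hypergraph presented by the stream `hardStream φ f i`. -/
@[simps]
def hardHypergraph (f : Fin m → X → Y) (i : Fin m) : StreamHypergraph n (m + 1) where
  edge := hardStream φ f i
  edge_nonempty := hardStream_nonempty φ f i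
  no_isolated v := by
    by_cases hv : v ∈ graphEdge φ (f i)
    · exact ⟨i.castSucc, by simpa using hv⟩
    · exact ⟨Fin.last m, by simpa using hv⟩

theorem optCard_hardHypergraph_le_two (f : Fin m → X → Y) (i : Fin m) :
    (hardHypergraph φ f i).optCard ≤ 2 := by
  refine (StreamHypergraph.optCard_le_card (F := {i.castSucc, Fin.last m}) ?_).trans card_le_two
  apply StreamHypergraph.isCover_one_of_coveredBy_eq_univ
  simp [StreamHypergraph.coveredBy, biUnion_insert]

variable {φ} in
theorem card_sub_le_of_isCover_hardHypergraph [DecidableEq Y] {f : Fin m → X → Y} {i : Fin m}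
    {ε : ℝ} {F : Finset (Fin (m + 1))} (hF : (hardHypergraph φ f i).IsCover (1 - ε) F)
    (hi : i.castSucc ∉ F) {t : ℕ} (ht : ∀ j ≠ i, #{x | f j x = f i x} ≤ t) :
    (Fintype.card X : ℝ) - ε * n ≤ #F * t := by
  rw [← card_graphEdge φ (f i)]
  refine hF.card_sub_le_card_mul fun k hk => ?_
  rw [hardHypergraph_edge]
  induction k using Fin.lastCases with
  | last => simp
  | cast j =>
    rw [hardStream_castSucc]
    refine (card_graphEdge_inter_le φ _ _).trans (ht j ?_)
    rintro rfl
    exact hi hk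

end HardHypergraph

namespace StreamAlg

variable {n s m : ℕ}

/-- The memory image of the algorithm after the stream `edge 0, edge 1, …, edge (m - 1)`. -/
def memoryAfter (A : StreamAlg n s) (edge : Fin m → Finset (Fin n)) : Fin s → Bool :=
  Fin.foldl m (fun mem t => A.update t (edge t) mem) A.init

theorem run_snoc (A : StreamAlg n s) (edge : Fin m → Finset (Fin n)) (e : Finset (Fin n)) :
    A.run (Fin.snoc (α := fun _ => Finset (Fin n)) edge e) =
      A.output (m + 1) (A.update m e (A.memoryAfter edge)) := by
  simp [run, memoryAfter, Fin.foldl_succ_last]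

variable {X Y : Type*} [Fintype X] (φ : X × Y ↪ Fin n)

/-- The indices `i` for which the algorithm, closing a hard stream with the complement of the
graph of `g` from the memory image `mem`, outputs the edge `i`; outputs of more than `R` edges are
discarded. -/
noncomputable def shortGuess (A : StreamAlg n s) (m : ℕ) (R : ℝ) (mem : Fin s → Bool)
    (g : X → Y) : Finset (Fin m) :=
  {i | (#(A.output (m + 1) (A.update m (graphEdge φ g)ᶜ mem)) : ℝ) ≤ R ∧
    i.castSucc ∈ A.output (m + 1) (A.update m (graphEdge φ g)ᶜ mem)}

theorem card_shortGuess_le (A : StreamAlg n s) {R : ℝ} (hR : 0 ≤ R) (mem : Fin s → Bool)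
    (g : X → Y) : (#(A.shortGuess φ m R mem g) : ℝ) ≤ R := by
  by_cases h : (#(A.output (m + 1) (A.update m (graphEdge φ g)ᶜ mem)) : ℝ) ≤ R
  · refine le_trans (mod_cast ?_) h
    exact card_le_card_of_injOn Fin.castSucc (fun i hi => by simp_all [shortGuess])
      (Fin.castSucc_injective m).injOn
  · simpa [shortGuess, h] using hR

theorem mem_shortGuess_memoryAfter {A : StreamAlg n s} {R : ℝ} {f : Fin m → X → Y} {i : Fin m} :
    i ∈ A.shortGuess φ m R (A.memoryAfter fun j => graphEdge φ (f j)) (f i) ↔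
      (#(A.run (hardStream φ f i)) : ℝ) ≤ R ∧ i.castSucc ∈ A.run (hardStream φ f i) := by
  simp [shortGuess, hardStream, run_snoc]

theorem expect_mem_shortGuess_le [DecidableEq X] [Fintype Y] [Nonempty Y] [NeZero m]
    (A : StreamAlg n s) {R : ℝ} (hR : 0 ≤ R)
    (hm : 4 * (s * Real.log 2 + R) ≤ m * Real.log 2) :
    𝔼 f : Fin m → X → Y, 𝔼 i,
      (if i ∈ A.shortGuess φ m R (A.memoryAfter fun j => graphEdge φ (f j)) (f i)
        then (1 : ℝ) else 0) ≤ 1 / 4 := by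
  have h := expect_card_guess_mul_log_two_le
    (fun f : Fin m → X → Y => A.memoryAfter fun j => graphEdge φ (f j))
    (A.card_shortGuess_le φ (m := m) hR)
  have hm0 : (0 : ℝ) < m := mod_cast Nat.pos_of_neZero m
  have log_two_pos : 0 < Real.log 2 := Real.log_pos one_lt_two
  have log_card : Real.log (Fintype.card (Fin s → Bool)) = s * Real.log 2 := by
    simp
  rw [log_card] at h
  simp only [Fintype.expect_eq_sum_div_card (ι := Fin m), sum_boole, Fintype.card_fin,
    ← expect_div]
  rw [div_le_iff₀ hm0]
  refine le_of_mul_le_mul_right ?_ log_two_pos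
  linarith

variable {φ} in
theorem le_card_run_hardStream [Nonempty X] [DecidableEq Y] [Nontrivial Y] {A : StreamAlg n s}
    {ε R : ℝ} {t : ℕ}
    (hRt : R * t < Fintype.card X - ε * n) {f : Fin m → X → Y} {i : Fin m}
    (hA : (hardHypergraph φ f i).IsCover (1 - ε) (A.run (hardStream φ f i)))
    (hguess : i ∉ A.shortGuess φ m R (A.memoryAfter fun j => graphEdge φ (f j)) (f i))
    (hagree : ¬∃ j ≠ i, t ≤ #{x | f j x = f i x}) :
    R ≤ #(A.run (hardStream φ f i)) := by
  by_contra! hlt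
  rw [mem_shortGuess_memoryAfter, not_and] at hguess
  push Not at hagree
  have := card_sub_le_of_isCover_hardHypergraph hA (hguess hlt.le) fun j hj => (hagree j hj).le
  have : (#(A.run (hardStream φ f i)) : ℝ) * t ≤ R * t := by gcongr
  linarith

theorem half_le_expect_card_run_hardStream [Nonempty X] [DecidableEq X] [Fintype Y] [Nontrivial Y]
    [NeZero m] (A : StreamAlg n s) {ε R : ℝ} (hR : 0 ≤ R) {t : ℕ}
    (hm : 4 * (s * Real.log 2 + R) ≤ m * Real.log 2)
    (ht : 4 * (m * Real.exp (Fintype.card X / Fintype.card Y)) ≤ 2 ^ t)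
    (hRt : R * t < Fintype.card X - ε * n)
    (hA : ∀ (f : Fin m → X → Y) (i : Fin m),
      (hardHypergraph φ f i).IsCover (1 - ε) (A.run (hardStream φ f i))) :
    R / 2 ≤ 𝔼 f : Fin m → X → Y, 𝔼 i, (#(A.run (hardStream φ f i)) : ℝ) := by
  classical
  let guess (f : Fin m → X → Y) (i : Fin m) : ℝ :=
    if i ∈ A.shortGuess φ m R (A.memoryAfter fun j => graphEdge φ (f j)) (f i) then 1 else 0
  let agree (f : Fin m → X → Y) (i : Fin m) : ℝ :=
    if ∃ j ≠ i, t ≤ #{x | f j x = f i x} then 1 else 0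
  have guess_le : 𝔼 f, 𝔼 i, guess f i ≤ 1 / 4 := A.expect_mem_shortGuess_le φ hR hm
  have agree_le : 𝔼 f, 𝔼 i, agree f i ≤ 1 / 4 := by
    rw [expect_comm]
    refine expect_le univ_nonempty fun i _ => (expect_exists_agree_le i t).trans ?_
    rw [Fintype.card_fin, ← mul_div_assoc, div_le_iff₀ (by positivity)]
    linarith
  have pointwise (f i) : R ≤ #(A.run (hardStream φ f i)) + R * guess f i + R * agree f i := by
    have : (0 : ℝ) ≤ #(A.run (hardStream φ f i)) := by positivity
    simp only [guess, agree]
    split_ifs with h₁ h₂ h₂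
    iterate 3 linarith
    linarith [le_card_run_hardStream hRt (hA f i) h₁ h₂]
  have averaged : R ≤ 𝔼 f : Fin m → X → Y, 𝔼 i, (#(A.run (hardStream φ f i)) : ℝ) +
      R * (𝔼 f, 𝔼 i, guess f i) + R * (𝔼 f, 𝔼 i, agree f i) := by
    simp only [mul_expect, ← expect_add_distrib]
    exact le_expect univ_nonempty fun f _ => le_expect univ_nonempty fun i _ => pointwise f i
  linarith [mul_le_mul_of_nonneg_left guess_le hR, mul_le_mul_of_nonneg_left agree_le hR]

end StreamAlg

namespace RandStreamAlg

variable {n s m M : ℕ} {A : RandStreamAlg.{u} n s} {ε ρ : ℝ}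

theorem integrable_card_run (A : RandStreamAlg.{u} n s) (edge : Fin m → Finset (Fin n)) :
    Integrable (fun ω => (#((A.alg ω).run edge) : ℝ)) A.P := by
  let _ : MeasurableSpace (Finset (Fin m)) := ⊤
  have measurable_run : Measurable (fun ω => (A.alg ω).run edge) :=
    measurable_to_countable' fun F => A.measurableSet_run m edge F
  have measurable_card : Measurable (fun ω => (#((A.alg ω).run edge) : ℝ)) :=
    (measurable_from_top (f := fun F : Finset (Fin m) => (#F : ℝ))).comp measurable_run
  refine Integrable.of_bound measurable_card.aestronglyMeasurable (m : ℝ)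
    (Filter.Eventually.of_forall fun ω => ?_)
  simpa using card_le_univ ((A.alg ω).run edge)

theorem IsUncertified.one_le (hA : A.IsUncertified M ε ρ) (hn : 0 < n) (hM : 1 ≤ M)
    (hε : ε < 1) : 1 ≤ ρ := by
  let G : StreamHypergraph n 1 :=
    { edge := fun _ => univ
      edge_nonempty := fun _ => ⟨⟨0, hn⟩, mem_univ _⟩
      no_isolated := fun v => ⟨0, mem_univ v⟩ }
  obtain ⟨isCover, integral_le⟩ := hA 1 hM G
  have optCard_le : G.optCard ≤ 1 :=
    StreamHypergraph.optCard_le_card (F := {0}) <|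
      StreamHypergraph.isCover_one_of_coveredBy_eq_univ (by simp [StreamHypergraph.coveredBy, G])
  have one_le_integral : (1 : ℝ) ≤ ∫ ω, (#((A.alg ω).run G.edge) : ℝ) ∂A.P := by
    calc (1 : ℝ) = ∫ _, (1 : ℝ) ∂A.P := by simp
      _ ≤ _ := by
        refine integral_mono_ae (integrable_const _) (A.integrable_card_run _) ?_
        filter_upwards [isCover] with ω hω
        exact mod_cast (hω.nonempty (by linarith) hn).card_pos
  have one_le_mul := one_le_integral.trans integral_le
  interval_cases G.optCard <;> norm_num at one_le_mul
  exact one_le_mul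

theorem IsUncertified.quarter_le_of_grid (hA : A.IsUncertified M ε ρ) (hρ : 0 ≤ ρ)
    {X Y : Type*} [Fintype X] [Nonempty X] [Fintype Y] [Nontrivial Y] (φ : X × Y ↪ Fin n) {R : ℝ}
    (hR : 0 ≤ R) {t : ℕ} [NeZero m] (hM : m < M)
    (hm : 4 * (s * Real.log 2 + R) ≤ m * Real.log 2)
    (ht : 4 * (m * Real.exp (Fintype.card X / Fintype.card Y)) ≤ 2 ^ t)
    (hRt : R * t < Fintype.card X - ε * n) :
    R / 4 ≤ ρ := by
  classical
  have covers : ∀ᵐ ω ∂A.P, ∀ (f : Fin m → X → Y) (i : Fin m),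
      (hardHypergraph φ f i).IsCover (1 - ε) ((A.alg ω).run (hardStream φ f i)) :=
    ae_all_iff.mpr fun f => ae_all_iff.mpr fun i => (hA (m + 1) hM (hardHypergraph φ f i)).1
  obtain ⟨⟨f, i⟩, le_integral⟩ := exists_le_integral_of_ae_le_expect (c := R / 2)
    (fun p : (Fin m → X → Y) × Fin m => A.integrable_card_run (hardStream φ p.1 p.2)) <| by
      filter_upwards [covers] with ω hω
      rw [← univ_product_univ, expect_product]
      exact (A.alg ω).half_le_expect_card_run_hardStream φ hR hm ht hRt hω
  have integral_le := (hA (m + 1) hM (hardHypergraph φ f i)).2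
  have optCard_le : ((hardHypergraph φ f i).optCard : ℝ) ≤ 2 :=
    mod_cast optCard_hardHypergraph_le_two φ f i
  linarith [le_integral.trans integral_le, mul_le_mul_of_nonneg_left optCard_le hρ]

end RandStreamAlg

section Parameters

theorem exists_grid_dimensions {n : ℕ} {ε : ℝ} (hε0 : 0 < ε) (hε : ε < 1 / 8)
    (hεn : 1 ≤ ε ^ 2 * n) :
    ∃ a b : ℕ, 2 ≤ b ∧ a * b ≤ n ∧ 2 * (ε * n) ≤ a ∧ (a : ℝ) / b ≤ 16 * (ε ^ 2 * n) := by
  set y := 1 / (4 * ε) with hy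
  set b := ⌈y⌉₊
  have y_mul : y * ε = 1 / 4 := by rw [hy]; field_simp
  have two_lt_y : 2 < y := by rw [hy, lt_div_iff₀ (by positivity)]; linarith
  have y_le_b : y ≤ b := Nat.le_ceil y
  have b_lt : b < y + 1 := Nat.ceil_lt_add_one (by positivity)
  have b_pos : (0 : ℝ) < b := by linarith
  have inv_b_le : 1 / (b : ℝ) ≤ 4 * ε := by rw [div_le_iff₀ b_pos]; nlinarith
  have le_inv_b : 8 / 3 * ε ≤ 1 / (b : ℝ) := by rw [le_div_iff₀ b_pos]; nlinarith
  have a_le : ((n / b : ℕ) : ℝ) ≤ n * (1 / b) := by simpa [div_eq_mul_inv] using Nat.cast_div_le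
  have lt_a : (n : ℝ) * (1 / b) - 1 < (n / b : ℕ) := by
    have h := Nat.sub_one_lt_floor ((n : ℝ) / b)
    rwa [Nat.floor_div_natCast, Nat.floor_natCast, div_eq_mul_one_div] at h
  refine ⟨n / b, b, mod_cast (two_lt_y.trans_le y_le_b).le, Nat.div_mul_le_self n b, ?_, ?_⟩
  · have : 8 ≤ ε * n := by nlinarith
    have : 8 / 3 * ε * n ≤ n * (1 / b) := by rw [mul_comm (n : ℝ)]; gcongr
    linarith
  · calc ((n / b : ℕ) : ℝ) / b ≤ n * (1 / b) * (1 / b) := by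
          rw [div_eq_mul_one_div]; gcongr
      _ ≤ n * (4 * ε) * (4 * ε) := by gcongr
      _ = 16 * (ε ^ 2 * n) := by ring

theorem eventually_three_mul_log_le_rpow {α : ℝ} (hα : 0 < α) :
    ∀ᶠ n : ℕ in Filter.atTop, 3 * Real.log n ≤ (n : ℝ) ^ (2 * α) := by
  have isLittleO := (isLittleO_log_rpow_atTop (r := 2 * α) (by positivity)).bound
    (show (0 : ℝ) < 1 / 3 by norm_num)
  filter_upwards [tendsto_natCast_atTop_atTop.eventually isLittleO] with n hn
  rw [Real.norm_of_nonneg (Real.log_natCast_nonneg n), Real.norm_of_nonneg (by positivity)] at hn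
  linarith

theorem rpow_two_mul_le_sq_mul {x α ε : ℝ} (hx : 0 < x) (hε : x ^ (-(1 / 2) + α) ≤ ε) :
    x ^ (2 * α) ≤ ε ^ 2 * x := by
  calc x ^ (2 * α) = (x ^ (-(1 / 2) + α)) ^ 2 * x := by
        rw [← Real.rpow_mul_natCast hx.le, ← Real.rpow_add_one hx.ne']
        congr 1
        push_cast
        ring
    _ ≤ ε ^ 2 * x := by gcongr

theorem rpow_one_add_le_sq {x α : ℝ} (hx : 1 ≤ x) (hα : x ^ (-(1 / 2) + α) < 1) :
    x ^ (1 + α) ≤ x ^ 2 := by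
  have α_lt : -(1 / 2) + α < 0 := by
    contrapose! hα
    exact Real.one_le_rpow hx hα
  calc x ^ (1 + α) ≤ x ^ (2 : ℝ) := Real.rpow_le_rpow_of_exponent_le hx (by linarith)
    _ = x ^ 2 := Real.rpow_two x

theorem mul_exp_le_two_pow {k x L : ℝ} {t : ℕ} (hk : 0 < k) (hkL : Real.log k ≤ L)
    (hxL : x ≤ 16 * L) (ht : 25 * L ≤ t) : k * Real.exp x ≤ 2 ^ t := by
  rw [← Real.log_le_log_iff (by positivity) (by positivity), Real.log_mul hk.ne' (by positivity),
    Real.log_exp, Real.log_pow]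
  nlinarith [Real.log_two_gt_d9]

end Parameters

theorem RandStreamAlg.IsUncertified.one_div_le_of_lt_eighth {n s M : ℕ} {ε ρ : ℝ}
    {A : RandStreamAlg.{u} n s} (hA : A.IsUncertified M ε ρ) (hρ : 0 ≤ ρ) (hε0 : 0 < ε)
    (hε : ε < 1 / 8) (hM : 4 * (s + n) < M) (hεn : 1 ≤ ε ^ 2 * n)
    (hlog : Real.log (16 * (s + n)) ≤ ε ^ 2 * n) :
    1 / (128 * ε) ≤ ρ := by
  obtain ⟨a, b, hb, hab, a_ge, hdiv⟩ := exists_grid_dimensions hε0 hε hεn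
  have log_two_gt := Real.log_two_gt_d9
  have natCast_n_pos : (0 : ℝ) < n := pos_of_mul_pos_right (by linarith) (sq_nonneg ε)
  have n_pos : 0 < n := mod_cast natCast_n_pos
  have εn_gt : 8 < ε * n := by nlinarith
  set R := 1 / (32 * ε)
  set t := ⌈25 * (ε ^ 2 * n)⌉₊
  have mul_R : ε * R = 1 / 32 := by simp only [R]; field_simp
  have t_ge : 25 * (ε ^ 2 * n) ≤ t := Nat.le_ceil _
  have t_le : t ≤ 26 * (ε ^ 2 * n) := by
    linarith [Nat.ceil_lt_add_one (show 0 ≤ 25 * (ε ^ 2 * n) by positivity)]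
  have R_le : R ≤ n * Real.log 2 := by
    rw [div_le_iff₀ (by positivity)]
    nlinarith
  have R_mul_t_lt : R * t < a - ε * n :=
    calc R * t ≤ R * (26 * (ε ^ 2 * n)) := by gcongr
      _ = 26 * (ε * R) * (ε * n) := by ring
      _ < a - ε * n := by rw [mul_R]; linarith
  have exp_le : 4 * ((4 * (s + n) : ℕ) * Real.exp (a / b)) ≤ 2 ^ t := by
    refine le_of_eq_of_le ?_ (mul_exp_le_two_pow (by positivity) hlog hdiv t_ge)
    push_cast
    ring
  have : NeZero (4 * (s + n)) := ⟨by omega⟩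
  have : Nonempty (Fin a) := ⟨0, by rify; linarith⟩
  have : Nontrivial (Fin b) := Fin.nontrivial_iff_two_le.mpr hb
  have quarter_le := hA.quarter_le_of_grid (R := R) hρ
    (finProdFinEquiv.toEmbedding.trans (Fin.castLEEmb hab)) (by positivity) hM
    (by push_cast; linarith) (by simpa using exp_le) (by simpa using R_mul_t_lt)
  calc 1 / (128 * ε) = R / 4 := by simp only [R]; field_simp; norm_num
    _ ≤ ρ := quarter_le

end EdgeCover

theorem mainTheorem6_general {n s M : ℕ} {ε ρ : ℝ} {A : EdgeCover.RandStreamAlg.{u} n s}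
    (hA : A.IsUncertified M ε ρ) (hn : 0 < n) (hε0 : 0 < ε) (hε1 : ε < 1)
    (hM : 4 * (s + n) < M) (hlog : Real.log (16 * (s + n)) ≤ ε ^ 2 * n) :
    1 / (128 * ε) ≤ ρ := by
  have one_le_ρ : 1 ≤ ρ := hA.one_le hn (by omega) hε1
  obtain hε | hε := le_or_gt (1 / 8) ε
  · refine le_trans ?_ one_le_ρ
    rw [div_le_one (by positivity)]
    linarith
  · have one_le_n : (1 : ℝ) ≤ n := mod_cast hn
    have one_le_log : 1 ≤ Real.log (16 * (s + n)) := by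
      rw [Real.le_log_iff_exp_le (by positivity)]
      linarith [Real.exp_one_lt_d9, (Nat.cast_nonneg s : (0 : ℝ) ≤ s)]
    exact hA.one_div_le_of_lt_eighth (by linarith) hε0 hε hM (one_le_log.trans hlog) hlog

theorem mainTheorem6 :
    ∃ K : ℕ, ∀ α : ℝ, 0 < α → ∃ κ : ℝ, 0 < κ ∧ ∃ c : ℝ, 0 < c ∧
      ∀ n₀ : ℕ, ∃ n : ℕ, n₀ ≤ n ∧
        ∀ ε : ℝ, (n : ℝ) ^ (-(1 / 2) + α : ℝ) ≤ ε → ε < 1 →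
          ∀ s : ℕ, (s : ℝ) ≤ κ * (n : ℝ) ^ (1 + α : ℝ) →
            ∀ ρ : ℝ, (∃ A : EdgeCover.RandStreamAlg.{u} n s, A.IsUncertified (n ^ K) ε ρ) →
              c * (Real.log (Real.log n) / Real.log n * (1 / ε)) ≤ ρ := by
  refine ⟨3, fun α hα => ⟨1, one_pos, 1 / 128, by norm_num, fun n₀ => ?_⟩⟩
  obtain ⟨n, log_le, n_ge, n₀_le⟩ := ((EdgeCover.eventually_three_mul_log_le_rpow hα).and
    ((Filter.eventually_ge_atTop 32).and (Filter.eventually_ge_atTop n₀))).exists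
  refine ⟨n, n₀_le, fun ε hε hε1 s hs ρ ⟨A, hA⟩ => ?_⟩
  have n_ge' : (32 : ℝ) ≤ n := mod_cast n_ge
  have ε_pos : 0 < ε := (Real.rpow_pos_of_pos (by linarith) _).trans_le hε
  have s_le : (s : ℝ) ≤ n ^ 2 :=
    hs.trans (by simpa using EdgeCover.rpow_one_add_le_sq (by linarith) (hε.trans_lt hε1))
  have edges_le : 16 * ((s : ℝ) + n) ≤ n ^ 3 := by nlinarith
  have edges_lt : 4 * (s + n) < n ^ 3 := by rify; linarith [(Nat.cast_nonneg s : (0 : ℝ) ≤ s)]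
  have log_edges_le : Real.log (16 * (s + n)) ≤ ε ^ 2 * n := by
    calc Real.log (16 * (s + n)) ≤ Real.log (n ^ 3) := Real.log_le_log (by positivity) edges_le
      _ = 3 * Real.log n := by simp
      _ ≤ n ^ (2 * α) := log_le
      _ ≤ ε ^ 2 * n := EdgeCover.rpow_two_mul_le_sq_mul (by linarith) hε
  calc 1 / 128 * (Real.log (Real.log n) / Real.log n * (1 / ε)) ≤ 1 / 128 * (1 * (1 / ε)) := by
        gcongr
        exact div_le_one_of_le₀ (Real.log_le_self (Real.log_natCast_nonneg n))
          (Real.log_natCast_nonneg n)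
    _ = 1 / (128 * ε) := by field_simp
    _ ≤ ρ := mainTheorem6_general hA (by omega) ε_pos hε1 edges_lt log_edges_le
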